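/- Let $k\ge 1$ and $n\ge 0$ be integers. A parking preference of length $n$ is a sequence $(a_1,\dots,a_n)\in\{1,\dots,n\}^n$. Cars $1,\dots,n$ arrive in this order on a one-way street with spots $1,\dots,n$. For an integer $j\ge 0$, under the $j$-Naples rule car $i$ parks in spot $a_i$ if it is free; otherwise it checks the spots $a_i-1,a_i-2,\dots$, one at a time, at most $j$ of them and not going below spot $1$, and parks in the first free one; if none of these is free, it parks in the first free spot after $a_i$, if there is one. The preference is a $j$-Naples parking function if all $n$ cars manage to park. It is strictly $k$-Naples if it is a $k$-Naples parking function but not a $(k-1)$-Naples parking function, and descending if $a_1\ge a_2\ge\dots\ge a_n$. A set partition of $[m]=\{1,\dots,m\}$ is non-crossing if there are no $a<b<c<d$ in $[m]$ such that $a,c$ lie in one block and $b,d$ lie in a different block. An $r$-rooted non-crossing partition of $[m]$ is a non-crossing set partition of $[m]$ together with one of its blocks, called the root, which has exactly $r$ elements. Then there is a bijection between the set of descending strictly $k$-Naples parking functions of length $n$ and the set of $(2k+2)$-rooted non-crossing partitions of $[n+k+1]$ whose root contains $1$. -/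

import Mathlib

namespace Naples

/-- The spots, out of `1, …, n`, that a car with preference `p` inspects under the `k`-Naples rule,
in the order of inspection: first `p`, then backwards `p - 1, p - 2, …` for at most `k` spots
(never below spot `1`), then forwards `p + 1, …, n`. -/
def candidates (k n p : ℕ) : List ℕ :=
  (List.range (min k (p - 1) + 1)).map (fun j => p - j) ++ List.range' (p + 1) (n - p)

/-- The spot taken by a car with preference `p` when the spots in `occ` are occupied: the first
free one that it inspects, or `none` if the car cannot park. -/
def parkSpot (k n : ℕ) (occ : Finset ℕ) (p : ℕ) : Option ℕ :=
  (candidates k n p).find? (fun s => decide (s ∉ occ))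

/-- Starting with the spots in `occ` occupied, all cars of the list (of preferences), arriving one
after the other, manage to park in the spots `1, …, n` under the `k`-Naples rule. -/
def AllPark (k n : ℕ) : Finset ℕ → List ℕ → Prop
  | _, [] => True
  | occ, p :: l =>
    match parkSpot k n occ p with
    | none => False
    | some s => AllPark k n (insert s occ) l

/-- `a` is a parking preference of length `n`: `n` cars, each preferring a spot in `{1, …, n}`. -/
def IsPreference (n : ℕ) (a : List ℕ) : Prop :=
  a.length = n ∧ ∀ p ∈ a, 1 ≤ p ∧ p ≤ n

/-- `a` is a `k`-Naples parking function of length `n`. -/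
def IsNaples (k n : ℕ) (a : List ℕ) : Prop :=
  IsPreference n a ∧ AllPark k n ∅ a

/-- `k`-Naples but not `(k - 1)`-Naples (meant for `k ≥ 1`). -/
def IsStrictlyNaples (k n : ℕ) (a : List ℕ) : Prop :=
  IsNaples k n a ∧ ¬ IsNaples (k - 1) n a

/-- The descending (weakly decreasing) strictly `k`-Naples parking functions of length `n`. -/
def descendingStrictlyNaples (k n : ℕ) : Set (List ℕ) :=
  {a | a.Pairwise (fun x y => y ≤ x) ∧ IsStrictlyNaples k n a}

/-- A set partition of `[m] = {1, …, m}` is non-crossing if there are no `a < b < c < d` with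
`a, c` in one block and `b, d` in a different block. -/
def IsNoncrossing {m : ℕ} (P : Finpartition (Finset.Icc 1 m)) : Prop :=
  ∀ A ∈ P.parts, ∀ B ∈ P.parts, ∀ a ∈ A, ∀ b ∈ B, ∀ c ∈ A, ∀ d ∈ B,
    a < b → b < c → c < d → A = B

/-- An `r`-rooted non-crossing partition of `[m]`: a non-crossing set partition together with one
of its blocks, the root, which has size `r`. -/
structure RootedNoncrossing (r m : ℕ) where
  partition : Finpartition (Finset.Icc 1 m)
  noncrossing : IsNoncrossing partition
  root : Finset ℕ
  root_mem : root ∈ partition.parts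
  root_card : root.card = r

end Naples

namespace Naples

/-! The two sets are finite and have the same size; the bijection on the whole is not explicit. A
descending preference is `k`-Naples exactly when a car with preference `p` arriving after `c` others
satisfies `c + p ≤ n + k` (`isNaples_iff_below`). Reversed, such lists are lattice paths under a
shifted line, counted by ballot numbers, so the strict ones number `ballot k n n - ballot (k - 1) n
n`. A non-crossing partition is encoded by its function of block minima. If the block of `1`
contains `[j]`, then `j + 1` either lies in it or is a block minimum; in the second case, moving the
last element of the block of `j + 1` into the root enlarges the root by one, reversibly
(`encard_noncrossingMin_split`). This is again the ballot recursion, now with shift `0`. The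
reflection formula `ballot_add_choose` and Pascal's rule identify the two counts. -/

/-! ### Ballot numbers. -/

/-- Ballot numbers, given by the recursion that counts weakly monotone sequences of length `s`
with `l` available values below a line shifted by `b`. -/
def ballot (b : ℕ) : ℕ → ℕ → ℕ
  | _, 0 => 1
  | 0, _ + 1 => 0
  | l + 1, s + 1 => if s ≤ l + b then ballot b l (s + 1) + ballot b (l + 1) s else 0

/-- Reflection principle, stated additively to avoid truncated subtraction. At `s = l + b + 2` the
two binomials agree and the ballot number is `0`; the bound on `s` stops there. -/
theorem ballot_add_choose (b l s : ℕ) (h : s ≤ l + b + 2) :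
    ballot b (l + 1) s + (l + s).choose (l + b + 2) = (l + s).choose l := by
  induction l generalizing s with
  | zero =>
    induction s with
    | zero => simp [ballot]
    | succ s ih =>
      have := ih (by omega)
      rcases Nat.lt_or_ge b s with hb | hb
      · obtain rfl : s = b + 1 := by omega
        simp [ballot]
      · have h1 : s.choose (b + 2) = 0 := Nat.choose_eq_zero_of_lt (by omega)
        have h2 : (s + 1).choose (b + 2) = 0 := Nat.choose_eq_zero_of_lt (by omega)
        simp_all [ballot]
  | succ l ihl =>
    induction s with
    | zero => simp [ballot, Nat.choose_eq_zero_of_lt (show l + 1 < l + 1 + b + 2 by omega)]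
    | succ s ihs =>
      rcases Nat.lt_or_ge (l + 1 + b) s with hb | hb
      · obtain rfl : s = l + b + 2 := by omega
        have : ¬ (l + b + 2 ≤ l + 1 + b) := by omega
        simp only [ballot, this, if_false, zero_add]
        rw [← Nat.choose_symm_of_eq_add]
        omega
      · have h1 := ihl (s + 1) (by omega)
        have h2 := ihs (by omega)
        rw [ballot, if_pos hb]
        rw [show l + 1 + (s + 1) = (l + 1 + s) + 1 by ring,
          show l + 1 + b + 2 = (l + b + 2) + 1 by ring, Nat.choose_succ_succ,
          Nat.choose_succ_succ]
        rw [show l + (s + 1) = l + 1 + s by ring] at h1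
        rw [show l + 1 + b + 2 = (l + b + 2) + 1 by ring] at h2
        simp only [Nat.succ_eq_add_one]
        omega

/-- The number of sequences that touch the line shifted by `k` without crossing it is again a
ballot number. -/
theorem ballot_touching (k d : ℕ) :
    ballot (k + 1) (d + k + 2) (d + k + 2) =
      ballot k (d + k + 2) (d + k + 2) + ballot 0 (d + 2 * k + 3) d := by
  have h1 := ballot_add_choose (k + 1) (d + k + 1) (d + k + 2) (by omega)
  have h2 := ballot_add_choose k (d + k + 1) (d + k + 2) (by omega)
  have h3 := ballot_add_choose 0 (d + 2 * k + 2) d (by omega)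
  -- With `n = d + k + 2`, the left-hand difference is `C(2n-1, n+k+1) - C(2n-1, n+k+2)`; Pascal
  -- turns it into `C(2n-2, n+k) - C(2n-2, n+k+2)`, the reflection formula for the last term.
  rw [show d + k + 1 + (d + k + 2) = (d + 2 * k + 2 + d) + 1 by ring] at h1 h2
  rw [show d + k + 1 + (k + 1) + 2 = (d + 2 * k + 3) + 1 by ring, Nat.choose_succ_succ] at h1
  rw [show d + k + 1 + k + 2 = (d + 2 * k + 2) + 1 by ring, Nat.choose_succ_succ] at h2
  simp only [Nat.succ_eq_add_one, Nat.add_assoc, Nat.reduceAdd] at *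
  omega

theorem ballot_mono_of_le (k n : ℕ) (h : n ≤ k + 1) : ballot (k + 1) n n = ballot k n n := by
  rcases n with _ | n
  · simp [ballot]
  have h1 := ballot_add_choose (k + 1) n (n + 1) (by omega)
  have h2 := ballot_add_choose k n (n + 1) (by omega)
  rw [Nat.choose_eq_zero_of_lt (by omega)] at h1 h2
  omega

/-! ### Descending Naples functions as an inequality. -/

/-- A car with preference `p` arriving after `c` others satisfies `c + p ≤ n + k`. -/
def Below (k n : ℕ) : ℕ → List ℕ → Prop
  | _, [] => True
  | c, p :: l => c + p ≤ n + k ∧ Below k n (c + 1) l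

theorem below_append_singleton (k n c x : ℕ) (l : List ℕ) :
    Below k n c (l ++ [x]) ↔ Below k n c l ∧ c + l.length + x ≤ n + k := by
  induction l generalizing c with
  | nil => simp [Below]
  | cons p l ih =>
    simp only [List.cons_append, Below, ih, List.length_cons, and_assoc]
    rw [show c + 1 + l.length = c + (l.length + 1) by ring]

theorem mem_candidates {k n p s : ℕ} (hp : 1 ≤ p) (hpn : p ≤ n) :
    s ∈ candidates k n p ↔ 1 ≤ s ∧ p ≤ s + k ∧ s ≤ n := by
  simp only [candidates, List.mem_append, List.mem_map, List.mem_range, List.mem_range'_1]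
  constructor
  · rintro (⟨j, hj, rfl⟩ | h) <;> omega
  · rintro ⟨h1, h2, h3⟩
    rcases Nat.lt_or_ge p s with h | h
    · right; omega
    · left; exact ⟨p - s, by omega, by omega⟩

theorem card_reachable_spots {k n p : ℕ} (hp : 1 ≤ p) (hpn : p ≤ n) :
    min n (n + k + 1 - p) = (Finset.Icc (max 1 (p - k)) n).card := by
  simp only [Nat.card_Icc]; omega

/-- A car that cannot park sees all of `[max 1 (p - k), n]` occupied, which takes more cars than
have arrived. No monotonicity is needed in this direction. -/
theorem allPark_of_below {k n : ℕ} {l : List ℕ} {occ : Finset ℕ}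
    (hl : ∀ p ∈ l, 1 ≤ p ∧ p ≤ n) (hlen : occ.card + l.length ≤ n)
    (hb : Below k n occ.card l) : AllPark k n occ l := by
  induction l generalizing occ with
  | nil => trivial
  | cons p l ih =>
    obtain ⟨hp, hpn⟩ := hl p (by simp)
    simp only [List.length_cons] at hlen
    simp only [AllPark]
    split
    · next h =>
      rw [parkSpot, List.find?_eq_none] at h
      have hsub : Finset.Icc (max 1 (p - k)) n ⊆ occ := by
        intro s hs
        simp only [Finset.mem_Icc] at hs
        have := h s ((mem_candidates hp hpn).2 (by omega))
        simpa using this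
      have := Finset.card_le_card hsub
      rw [← card_reachable_spots hp hpn] at this
      have := hb.1
      omega
    · next s h =>
      have hs : s ∉ occ := by simpa using List.find?_some h
      have hc := Finset.card_insert_of_notMem hs
      exact ih (fun q hq => hl q (by simp [hq])) (by omega) (by rw [hc]; exact hb.2)

/-- Earlier preferences are at least `p`, so every spot taken so far, including that of the present
car, is at least `p - k`; `c + 1` cars fit into `[max 1 (p - k), n]`. `hlow` is the invariant that
carries this through the induction. -/
theorem below_of_allPark {k n : ℕ} {l : List ℕ} {occ : Finset ℕ}
    (hl : ∀ p ∈ l, 1 ≤ p ∧ p ≤ n) (hd : l.Pairwise (fun x y => y ≤ x))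
    (hocc : ∀ s ∈ occ, 1 ≤ s ∧ s ≤ n) (hlow : ∀ s ∈ occ, ∀ p ∈ l, p ≤ s + k)
    (h : AllPark k n occ l) : Below k n occ.card l := by
  induction l generalizing occ with
  | nil => trivial
  | cons p l ih =>
    obtain ⟨hp, hpn⟩ := hl p (by simp)
    rw [List.pairwise_cons] at hd
    simp only [AllPark] at h
    split at h
    · exact h.elim
    · next s hs =>
      have hso : s ∉ occ := by simpa using List.find?_some hs
      have hsc := (mem_candidates hp hpn).1 (List.mem_of_find?_eq_some hs)
      have hc := Finset.card_insert_of_notMem hso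
      have hsub : insert s occ ⊆ Finset.Icc (max 1 (p - k)) n := by
        intro t ht
        simp only [Finset.mem_Icc]
        rcases Finset.mem_insert.1 ht with rfl | ht
        · omega
        · have := hocc t ht
          have := hlow t ht p (by simp)
          omega
      have hcard := Finset.card_le_card hsub
      rw [← card_reachable_spots hp hpn, hc] at hcard
      refine ⟨by omega, ?_⟩
      rw [← hc]
      refine ih (fun q hq => hl q (by simp [hq])) hd.2 ?_ ?_ h
      · intro t ht
        have := Finset.mem_Icc.1 (hsub ht)
        omega
      · intro t ht q hq
        have := Finset.mem_Icc.1 (hsub ht)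
        have := hd.1 q hq
        omega

theorem isNaples_iff_below {k n : ℕ} {a : List ℕ} (hd : a.Pairwise (fun x y => y ≤ x)) :
    IsNaples k n a ↔ IsPreference n a ∧ Below k n 0 a := by
  refine and_congr_right fun ⟨hlen, hl⟩ => ⟨fun h => ?_, fun h => ?_⟩
  · simpa using below_of_allPark hl hd (occ := ∅) (by simp) (by simp) h
  · exact allPark_of_below hl (by simp [hlen]) (by simpa using h)

/-! ### Counting descending Naples functions. -/

/-- Weakly increasing lists of length `s` with values in `[q, n]` whose reverses are `Below`. -/
def increasingBelow (b n q s : ℕ) : Set (List ℕ) :=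
  {a | a.length = s ∧ (∀ x ∈ a, q ≤ x ∧ x ≤ n) ∧ a.Pairwise (fun x y => x ≤ y) ∧
    Below b n 0 a.reverse}

theorem cons_mem_increasingBelow {b n q s x : ℕ} {a : List ℕ} :
    x :: a ∈ increasingBelow b n q (s + 1) ↔
      q ≤ x ∧ x ≤ n ∧ s + x ≤ n + b ∧ a ∈ increasingBelow b n x s := by
  simp only [increasingBelow, Set.mem_ofPred_eq, List.length_cons, Nat.add_right_cancel_iff,
    List.mem_cons, forall_eq_or_imp, List.pairwise_cons, List.reverse_cons,
    below_append_singleton, List.length_reverse, zero_add]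
  constructor
  · rintro ⟨rfl, ⟨⟨h1, h2⟩, h3⟩, ⟨h4, h5⟩, h6, h7⟩
    exact ⟨h1, h2, h7, rfl, fun y hy => ⟨h4 y hy, (h3 y hy).2⟩, h5, h6⟩
  · rintro ⟨h1, h2, h7, rfl, h3, h5, h6⟩
    exact ⟨rfl, ⟨⟨h1, h2⟩, fun y hy => ⟨h1.trans (h3 y hy).1, (h3 y hy).2⟩⟩,
      ⟨fun y hy => (h3 y hy).1, h5⟩, h6, h7⟩

theorem increasingBelow_zero (b n q : ℕ) : increasingBelow b n q 0 = {[]} := by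
  ext a
  cases a <;> simp [increasingBelow, Below]

/-- The head is either the least value `q` or larger, which is the ballot recursion with `l = n + 1
- q` values left. The head is the last car to arrive, after `s` others, so `q` is allowed iff `s + q
≤ n + b`; if `q` is not, nothing is. -/
theorem encard_increasingBelow (b n l q s : ℕ) (h : q + l = n + 1) :
    (increasingBelow b n q s).encard = ballot b l s := by
  induction l generalizing q s with
  | zero =>
    cases s with
    | zero => simp [increasingBelow_zero, ballot]
    | succ s =>
      suffices increasingBelow b n q (s + 1) = ∅ by simp [this, ballot]
      ext a
      cases a with
      | nil => simp [increasingBelow]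
      | cons x a =>
        simp only [cons_mem_increasingBelow, Set.mem_empty_iff_false, iff_false]
        omega
  | succ l ihl =>
    induction s with
    | zero => simp [increasingBelow_zero, ballot]
    | succ s ihs =>
      rcases Nat.lt_or_ge (l + b) s with hb | hb
      · suffices increasingBelow b n q (s + 1) = ∅ by
          simp [this, ballot, Nat.not_le.2 hb]
        ext a
        cases a with
        | nil => simp [increasingBelow]
        | cons x a =>
          simp only [cons_mem_increasingBelow, Set.mem_empty_iff_false, iff_false]
          omega
      · have hU : increasingBelow b n q (s + 1) =
            increasingBelow b n (q + 1) (s + 1) ∪ List.cons q '' increasingBelow b n q s := by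
          ext a
          cases a with
          | nil => simp [increasingBelow]
          | cons x a =>
            simp only [Set.mem_union, Set.mem_image, cons_mem_increasingBelow, List.cons.injEq,
              exists_eq_right_right]
            constructor
            · rintro ⟨h1, h2, h3, h4⟩
              rcases h1.eq_or_lt with rfl | h1
              · exact Or.inr ⟨h4, rfl⟩
              · exact Or.inl ⟨h1, h2, h3, h4⟩
            · rintro (⟨h1, h2, h3, h4⟩ | ⟨h1, rfl⟩)
              · exact ⟨by omega, h2, h3, h4⟩
              · exact ⟨le_rfl, by omega, by omega, h1⟩
        have hD : Disjoint (increasingBelow b n (q + 1) (s + 1))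
            (List.cons q '' increasingBelow b n q s) := by
          rw [Set.disjoint_right]
          rintro _ ⟨a, -, rfl⟩ h
          have := (cons_mem_increasingBelow.1 h).1
          omega
        rw [hU, Set.encard_union_eq hD, (List.cons_injective).encard_image, ihs,
          ihl (q + 1) (s + 1) (by omega)]
        simp [ballot, hb]

/-- The descending `k`-Naples parking functions of length `n`. -/
def descendingNaples (k n : ℕ) : Set (List ℕ) :=
  {a | a.Pairwise (fun x y => y ≤ x) ∧ IsNaples k n a}

theorem encard_descendingNaples (k n : ℕ) : (descendingNaples k n).encard = ballot k n n := by
  have : descendingNaples k n = List.reverse '' increasingBelow k n 1 n := by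
    ext a
    simp only [descendingNaples, Set.mem_ofPred_eq, Set.mem_image]
    constructor
    · rintro ⟨hd, h⟩
      obtain ⟨⟨h1, h2⟩, h3⟩ := (isNaples_iff_below hd).1 h
      exact ⟨a.reverse, ⟨by simpa using h1, by simpa using h2, by
        rwa [List.pairwise_reverse], by simpa using h3⟩, by simp⟩
    · rintro ⟨a, ⟨h1, h2, h3, h4⟩, rfl⟩
      have hd : a.reverse.Pairwise (fun x y => y ≤ x) := by rwa [List.pairwise_reverse]
      exact ⟨hd, (isNaples_iff_below hd).2 ⟨⟨by simpa using h1, by simpa using h2⟩, h4⟩⟩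
  rw [this, List.reverse_injective.encard_image, encard_increasingBelow _ _ n _ _ (by omega)]

theorem Below.mono {k k' n c : ℕ} {l : List ℕ} (hk : k ≤ k') (h : Below k n c l) :
    Below k' n c l := by
  induction l generalizing c with
  | nil => trivial
  | cons p l ih => exact ⟨h.1.trans (by omega), ih h.2⟩

theorem encard_descendingStrictlyNaples (k n : ℕ) :
    (descendingStrictlyNaples (k + 1) n).encard + ballot k n n = ballot (k + 1) n n := by
  have hsub : descendingNaples k n ⊆ descendingNaples (k + 1) n := by
    rintro a ⟨hd, h⟩
    rw [isNaples_iff_below hd] at h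
    exact ⟨hd, (isNaples_iff_below hd).2 ⟨h.1, h.2.mono (by omega)⟩⟩
  have : descendingStrictlyNaples (k + 1) n =
      descendingNaples (k + 1) n \ descendingNaples k n := by
    ext a
    simp only [descendingStrictlyNaples, descendingNaples, IsStrictlyNaples, Set.mem_ofPred_eq,
      Set.mem_sdiff, Nat.add_sub_cancel]
    tauto
  rw [this, ← encard_descendingNaples, ← encard_descendingNaples,
    Set.encard_sdiff_add_encard_of_subset hsub]


/-! ### Counting non-crossing partitions by their block minima. -/

/-- The functions sending each element of `[m]` to the least element of its block in some
non-crossing partition of `[m]` (and fixing everything outside `[m]`). -/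
structure IsNoncrossingMin (m : ℕ) (f : ℕ → ℕ) : Prop where
  eq_self : ∀ i, i ∉ Finset.Icc 1 m → f i = i
  pos : ∀ i, 1 ≤ i → 1 ≤ f i
  le_self : ∀ i, f i ≤ i
  idem : ∀ i, f (f i) = f i
  nested : ∀ b c, b < c → f c ≤ f b ∨ b ≤ f c

/-- The non-crossing partitions, encoded by their functions of block minima, in which the block
of `1` has `r` elements and contains `[j]`. -/
def noncrossingMin (m j r : ℕ) : Set (ℕ → ℕ) :=
  {f | IsNoncrossingMin m f ∧ (∀ i, 1 ≤ i → i ≤ j → f i = 1) ∧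
    ((Finset.Icc 1 m).filter (fun i => f i = 1)).card = r}

theorem IsNoncrossingMin.eq_one_of_le {m j : ℕ} {f : ℕ → ℕ} (hf : IsNoncrossingMin m f)
    (h1 : ∀ i, 1 ≤ i → i ≤ j → f i = 1) {i : ℕ} (hi : 1 ≤ i) (hij : f i ≤ j) : f i = 1 := by
  rw [← hf.idem i]
  exact h1 _ (hf.pos i hi) hij

/-- The least element after `j` of the block of `1`. -/
noncomputable def nextInRoot (j : ℕ) (f : ℕ → ℕ) : ℕ := sInf {i | j < i ∧ f i = 1}

/-- The greatest element of the block with minimum `j`. -/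
noncomputable def lastInBlock (j : ℕ) (f : ℕ → ℕ) : ℕ := sSup {i | f i = j}

/-- The root has `r + 1 > j` elements, so one exceeds `j` and the infimum is not the default `0`. -/
theorem isLeast_nextInRoot {m j r : ℕ} {f : ℕ → ℕ} (hj : j ≤ r)
    (hf : f ∈ noncrossingMin m j (r + 1)) :
    IsLeast {i | j < i ∧ f i = 1} (nextInRoot j f) := by
  obtain ⟨hf, h1, hr⟩ := hf
  have hne : {i | j < i ∧ f i = 1}.Nonempty := by
    by_contra hne
    rw [Set.not_nonempty_iff_eq_empty, Set.eq_empty_iff_forall_notMem] at hne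
    have hsub : (Finset.Icc 1 m).filter (fun i => f i = 1) ⊆ Finset.Icc 1 j := by
      intro i hi
      simp only [Finset.mem_filter, Finset.mem_Icc] at hi ⊢
      have := hne i
      simp only [Set.mem_ofPred_eq, not_and] at this
      exact ⟨hi.1.1, by by_contra h; exact this (by omega) hi.2⟩
    have := Finset.card_le_card hsub
    simp only [Nat.card_Icc] at this
    omega
  exact ⟨Nat.sInf_mem hne, fun i hi => Nat.sInf_le hi⟩

theorem isGreatest_lastInBlock {m j : ℕ} {f : ℕ → ℕ} (hf : IsNoncrossingMin m f)
    (hj : f j = j) (hjm : j ≤ m) : IsGreatest {i | f i = j} (lastInBlock j f) := by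
  have hbdd : BddAbove {i | f i = j} := by
    refine ⟨m, fun i hi => ?_⟩
    by_contra h
    have := hf.eq_self i (by simp only [Finset.mem_Icc]; omega)
    simp only [Set.mem_ofPred_eq] at hi
    omega
  exact ⟨Nat.sSup_mem ⟨j, hj⟩ hbdd, fun i hi => le_csSup hbdd hi⟩

/-- Moves the next root element `c` after `j` into the block of `j + 1`. Everything strictly between
`j` and `c` has block minimum at least `j + 1`, so no crossing arises; if `c = j + 1`, it becomes
the minimum of a block of its own. -/
theorem update_nextInRoot_mem {m j r : ℕ} {f : ℕ → ℕ} (hj : 1 ≤ j) (hjr : j ≤ r)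
    (hf : f ∈ noncrossingMin m j (r + 1)) :
    Function.update f (nextInRoot j f) (j + 1) ∈ noncrossingMin m j r ∧
      Function.update f (nextInRoot j f) (j + 1) (j + 1) = j + 1 ∧
      lastInBlock (j + 1) (Function.update f (nextInRoot j f) (j + 1)) = nextInRoot j f := by
  have hc := isLeast_nextInRoot hjr hf
  obtain ⟨hf, h1, hr⟩ := hf
  set c := nextInRoot j f
  obtain ⟨⟨hjc, hfc⟩, hmin⟩ := hc
  have hmin' : ∀ i, j < i → i < c → j + 1 ≤ f i := by
    intro i hi hic
    by_contra h
    have := hmin (show i ∈ {i | j < i ∧ f i = 1} from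
      ⟨hi, hf.eq_one_of_le h1 (by omega) (by omega)⟩)
    omega
  have hcm : c ≤ m := by
    by_contra h
    have := hf.eq_self c (by simp only [Finset.mem_Icc]; omega)
    omega
  have hfj : Function.update f c (j + 1) (j + 1) = j + 1 := by
    by_cases h : j + 1 = c
    · simp [← h]
    · rw [Function.update_of_ne h]
      have := hmin' (j + 1) (by omega) (by omega)
      have := hf.le_self (j + 1)
      omega
  have hN : IsNoncrossingMin m (Function.update f c (j + 1)) := by
    refine ⟨?_, ?_, ?_, ?_, ?_⟩
    · intro i hi
      rw [Function.update_of_ne, hf.eq_self i hi]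
      rintro rfl
      simp only [Finset.mem_Icc] at hi
      omega
    · intro i hi
      rw [Function.update_apply]
      split
      · omega
      · exact hf.pos i hi
    · intro i
      rw [Function.update_apply]
      split
      · omega
      · exact hf.le_self i
    · intro i
      by_cases hi : i = c
      · subst hi; rw [Function.update_self, hfj]
      · rw [Function.update_of_ne hi, Function.update_of_ne, hf.idem]
        intro h
        have := hf.idem i
        rw [h, hfc] at this
        omega
    · intro b d hbd
      simp only [Function.update_apply]
      split_ifs with hd hb hb
      · omega
      · subst hd
        by_cases h : b ≤ j + 1
        · exact Or.inr h
        · exact Or.inl (hmin' b (by omega) hbd)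
      · subst hb
        have := hf.nested c d hbd
        omega
      · exact hf.nested b d hbd
  refine ⟨⟨hN, ?_, ?_⟩, hfj, ?_⟩
  · intro i hi hij
    rw [Function.update_of_ne (by omega), h1 i hi hij]
  · have : (Finset.Icc 1 m).filter (fun i => Function.update f c (j + 1) i = 1) =
        ((Finset.Icc 1 m).filter (fun i => f i = 1)).erase c := by
      ext i
      simp only [Finset.mem_filter, Finset.mem_erase, Function.update_apply]
      split_ifs with h
      · simp [h]; omega
      · simp [h]
    rw [this, Finset.card_erase_of_mem, hr, Nat.add_sub_cancel]
    simp only [Finset.mem_filter, Finset.mem_Icc]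
    omega
  -- An `i > c` in the old block of `j + 1` would be enclosed by the root elements `1` and `c` only
  -- if `c = j + 1`, by nesting; but `c` is not a block minimum.
  · refine IsGreatest.csSup_eq ⟨by simp, fun i hi => ?_⟩
    by_contra hic
    simp only [Set.mem_ofPred_eq] at hi
    rw [Function.update_of_ne (by omega)] at hi
    have := hf.nested c i (by omega)
    have h : c = f i := by omega
    have := hf.idem i
    rw [← h] at this
    omega

/-- The inverse move: the last element of the block of `j + 1` joins the root. -/
theorem update_lastInBlock_mem {m j r : ℕ} {f : ℕ → ℕ} (hj : 1 ≤ j) (hjm : j < m)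
    (hf : f ∈ noncrossingMin m j r) (hfj : f (j + 1) = j + 1) :
    Function.update f (lastInBlock (j + 1) f) 1 ∈ noncrossingMin m j (r + 1) ∧
      nextInRoot j (Function.update f (lastInBlock (j + 1) f) 1) = lastInBlock (j + 1) f := by
  obtain ⟨hf, h1, hr⟩ := hf
  have hc := isGreatest_lastInBlock hf hfj (by omega)
  set c := lastInBlock (j + 1) f
  obtain ⟨hfc, hmax⟩ := hc
  simp only [Set.mem_ofPred_eq] at hfc
  have hjc : j + 1 ≤ c := hfc ▸ hf.le_self c
  have hmax' : ∀ i, c < i → f i ≠ j + 1 := by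
    intro i hi h
    have := hmax (show i ∈ {i | f i = j + 1} from h)
    omega
  have hcm : c ≤ m := by
    by_contra h
    have := hf.eq_self c (by simp only [Finset.mem_Icc]; omega)
    omega
  have hN : IsNoncrossingMin m (Function.update f c 1) := by
    refine ⟨?_, ?_, ?_, ?_, ?_⟩
    · intro i hi
      rw [Function.update_of_ne, hf.eq_self i hi]
      rintro rfl
      simp only [Finset.mem_Icc] at hi
      omega
    · intro i hi
      rw [Function.update_apply]
      split
      · omega
      · exact hf.pos i hi
    · intro i
      rw [Function.update_apply]
      split
      · omega
      · exact hf.le_self i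
    · intro i
      by_cases hi : i = c
      · subst hi; rw [Function.update_self, Function.update_of_ne (by omega), h1 1 le_rfl hj]
      · rw [Function.update_of_ne hi, Function.update_of_ne, hf.idem]
        intro h
        have h2 := hf.idem i
        rw [h, hfc] at h2
        have h3 := hf.le_self i
        have := hmax' i (by omega)
        omega
    · intro b d hbd
      simp only [Function.update_apply]
      split_ifs with hd hb hb
      · omega
      · rcases Nat.eq_zero_or_pos b with rfl | h
        · omega
        · exact Or.inl (hf.pos b h)
      · subst hb
        -- For `d > c`, nesting gives `f d ≤ j + 1` or `c ≤ f d`. Maximality of `c` excludes `f d =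
        -- j + 1`, and `f d ≤ j` forces `f d = 1`.
        rcases hf.nested c d hbd with h | h
        · have := hmax' d hbd
          have := hf.eq_one_of_le h1 (show 1 ≤ d by omega) (by omega)
          omega
        · exact Or.inr h
      · exact hf.nested b d hbd
  refine ⟨⟨hN, ?_, ?_⟩, ?_⟩
  · intro i hi hij
    rw [Function.update_of_ne (by omega), h1 i hi hij]
  · have : (Finset.Icc 1 m).filter (fun i => Function.update f c 1 i = 1) =
        insert c ((Finset.Icc 1 m).filter (fun i => f i = 1)) := by
      ext i
      simp only [Finset.mem_filter, Finset.mem_insert, Function.update_apply, Finset.mem_Icc]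
      split_ifs with h
      · simp [h]; omega
      · simp [h]
    rw [this, Finset.card_insert_of_notMem, hr]
    simp only [Finset.mem_filter, Finset.mem_Icc]
    omega
  · refine IsLeast.csInf_eq ⟨⟨by omega, by simp⟩, fun i hi => ?_⟩
    by_contra hic
    simp only [Set.mem_ofPred_eq] at hi
    rw [Function.update_of_ne (by omega)] at hi
    have := hf.nested i c (by omega)
    have h : i = j + 1 := by omega
    rw [h] at hi
    omega

theorem encard_noncrossingMin_split {m j r : ℕ} (hj : 1 ≤ j) (hjr : j ≤ r) (hjm : j < m) :
    (noncrossingMin m j r).encard =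
      (noncrossingMin m (j + 1) r).encard + (noncrossingMin m j (r + 1)).encard := by
  have hB : Set.BijOn (fun f => Function.update f (nextInRoot j f) (j + 1))
      (noncrossingMin m j (r + 1)) {f ∈ noncrossingMin m j r | f (j + 1) = j + 1} := by
    refine Set.InvOn.bijOn
      (f' := fun f => Function.update f (lastInBlock (j + 1) f) 1) ⟨?_, ?_⟩ ?_ ?_
    · intro f hf
      have h := update_nextInRoot_mem hj hjr hf
      have hc : f (nextInRoot j f) = 1 := (isLeast_nextInRoot hjr hf).1.2
      simp only
      rw [h.2.2, Function.update_idem, ← hc, Function.update_eq_self]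
    · rintro f ⟨hf, hfj⟩
      have h := update_lastInBlock_mem hj hjm hf hfj
      have hc : f (lastInBlock (j + 1) f) = j + 1 :=
        (isGreatest_lastInBlock hf.1 hfj (by omega)).1
      simp only
      rw [h.2, Function.update_idem]
      nth_rw 2 [← hc]
      rw [Function.update_eq_self]
    · intro f hf
      have h := update_nextInRoot_mem hj hjr hf
      exact ⟨h.1, h.2.1⟩
    · rintro f ⟨hf, hfj⟩
      exact (update_lastInBlock_mem hj hjm hf hfj).1
  have hU : noncrossingMin m j r =
      noncrossingMin m (j + 1) r ∪ {f ∈ noncrossingMin m j r | f (j + 1) = j + 1} := by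
    ext f
    constructor
    · intro h
      obtain ⟨hf, h1, hr⟩ := h
      by_cases hfj : f (j + 1) = j + 1
      · exact Or.inr ⟨⟨hf, h1, hr⟩, hfj⟩
      · refine Or.inl ⟨hf, fun i hi hij => ?_, hr⟩
        rcases Nat.lt_or_ge j i with h | h
        · obtain rfl : i = j + 1 := by omega
          have := hf.le_self (j + 1)
          exact hf.eq_one_of_le h1 hi (by omega)
        · exact h1 i hi h
    · rintro (⟨hf, h1, hr⟩ | h)
      · exact ⟨hf, fun i hi hij => h1 i hi (by omega), hr⟩
      · exact h.1
  have hD : Disjoint (noncrossingMin m (j + 1) r)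
      {f ∈ noncrossingMin m j r | f (j + 1) = j + 1} := by
    rw [Set.disjoint_left]
    rintro f ⟨-, h1, -⟩ ⟨-, h⟩
    have := h1 (j + 1) (by omega) le_rfl
    omega
  conv_lhs => rw [hU]
  rw [Set.encard_union_eq hD, ← hB.image_eq, hB.injOn.encard_image]

theorem noncrossingMin_eq_singleton {m j : ℕ} (hjm : j ≤ m) :
    noncrossingMin m j m = {fun i => if i ∈ Finset.Icc 1 m then 1 else i} := by
  ext f
  simp only [Set.mem_singleton_iff]
  constructor
  · rintro ⟨hf, -, hr⟩
    have h : (Finset.Icc 1 m).filter (fun i => f i = 1) = Finset.Icc 1 m :=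
      Finset.eq_of_subset_of_card_le (Finset.filter_subset _ _) (by simp [hr])
    rw [Finset.filter_eq_self] at h
    funext i
    split_ifs with hi
    · exact h i hi
    · exact hf.eq_self i hi
  · rintro rfl
    refine ⟨⟨?_, ?_, ?_, ?_, ?_⟩, ?_, ?_⟩
    · intro i hi; rw [if_neg hi]
    · intro i hi; split_ifs <;> omega
    · intro i
      split_ifs with h
      · exact (Finset.mem_Icc.1 h).1
      · exact le_rfl
    · intro i
      by_cases h : i ∈ Finset.Icc 1 m
      · simp only [if_pos h]; split_ifs <;> rfl
      · simp only [if_neg h]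
    · intro b c hbc
      simp only [Finset.mem_Icc]
      split_ifs <;> omega
    · intro i hi hij
      exact if_pos (Finset.mem_Icc.2 ⟨hi, by omega⟩)
    · rw [Finset.filter_true_of_mem (fun i hi => if_pos hi)]; simp

theorem noncrossingMin_eq_empty {m j r : ℕ} (hjm : j ≤ m) (h : r < j) :
    noncrossingMin m j r = ∅ := by
  rw [Set.eq_empty_iff_forall_notMem]
  rintro f ⟨-, h1, hr⟩
  have hsub : Finset.Icc 1 j ⊆ (Finset.Icc 1 m).filter (fun i => f i = 1) := by
    intro i hi
    simp only [Finset.mem_filter, Finset.mem_Icc] at hi ⊢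
    exact ⟨by omega, h1 i hi.1 hi.2⟩
  have := Finset.card_le_card hsub
  simp only [Nat.card_Icc] at this
  omega

/-- Here `l = m - j` and `s = m - r`, so the splitting becomes the ballot recursion, and its
condition `j ≤ r` becomes `s ≤ l`. -/
theorem encard_noncrossingMin {m j r l s : ℕ} (hj : 1 ≤ j) (hl : j + l = m) (hs : r + s = m) :
    (noncrossingMin m j r).encard = ballot 0 l s := by
  induction l generalizing j r s with
  | zero =>
    cases s with
    | zero =>
      obtain rfl : r = m := by omega
      rw [noncrossingMin_eq_singleton (by omega)]; simp [ballot]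
    | succ s =>
      rw [noncrossingMin_eq_empty (by omega) (by omega)]; simp [ballot]
  | succ l ihl =>
    induction s generalizing r with
    | zero =>
      obtain rfl : r = m := by omega
      rw [noncrossingMin_eq_singleton (by omega)]; simp [ballot]
    | succ s ihs =>
      rcases Nat.lt_or_ge r j with h | h
      · rw [noncrossingMin_eq_empty (by omega) h, ballot, if_neg (by omega)]; simp
      · rw [encard_noncrossingMin_split hj h (by omega), ihl (by omega) (by omega) hs,
          ihs (by omega), ballot, if_pos (by omega)]
        simp


/-! ### Partitions and their functions of block minima. -/

/-- The least element of the block of `i` (and `i` itself outside `[m]`). -/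
def blockMin {m : ℕ} (P : Finpartition (Finset.Icc 1 m)) (i : ℕ) : ℕ :=
  if h : i ∈ Finset.Icc 1 m then (P.part i).min' (P.part_nonempty.2 h) else i

theorem blockMin_mem {m : ℕ} {P : Finpartition (Finset.Icc 1 m)} {A : Finset ℕ} {i : ℕ}
    (hA : A ∈ P.parts) (hi : i ∈ A) : blockMin P i ∈ A := by
  have h : i ∈ Finset.Icc 1 m := P.le hA hi
  rw [blockMin, dif_pos h]
  exact (P.part_eq_of_mem hA hi).le (Finset.min'_mem (P.part i) (P.part_nonempty.2 h))

theorem blockMin_le {m : ℕ} {P : Finpartition (Finset.Icc 1 m)} {A : Finset ℕ} {i x : ℕ}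
    (hA : A ∈ P.parts) (hi : i ∈ A) (hx : x ∈ A) : blockMin P i ≤ x := by
  have h : i ∈ Finset.Icc 1 m := P.le hA hi
  rw [blockMin, dif_pos h]
  exact Finset.min'_le _ _ (by rwa [P.part_eq_of_mem hA hi])

theorem blockMin_eq_iff_mem {m : ℕ} {P : Finpartition (Finset.Icc 1 m)} {A : Finset ℕ} {i x : ℕ}
    (hA : A ∈ P.parts) (hi : i ∈ A) (hx : x ∈ Finset.Icc 1 m) :
    blockMin P x = blockMin P i ↔ x ∈ A := by
  constructor
  · intro h
    have h1 := blockMin_mem (P.part_mem.2 hx) (P.mem_part hx)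
    have h2 := blockMin_mem hA hi
    rw [← P.eq_of_mem_parts (P.part_mem.2 hx) hA h1 (h ▸ h2)]
    exact P.mem_part hx
  · intro h
    exact le_antisymm (blockMin_le hA h (blockMin_mem hA hi))
      (blockMin_le hA hi (blockMin_mem hA h))

theorem isNoncrossingMin_blockMin {m : ℕ} {P : Finpartition (Finset.Icc 1 m)}
    (hP : IsNoncrossing P) : IsNoncrossingMin m (blockMin P) := by
  have hself : ∀ i, i ∉ Finset.Icc 1 m → blockMin P i = i := fun i hi => by
    rw [blockMin, dif_neg hi]
  have hmem : ∀ i ∈ Finset.Icc 1 m, blockMin P i ∈ P.part i := fun i hi =>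
    blockMin_mem (P.part_mem.2 hi) (P.mem_part hi)
  have hle : ∀ i, blockMin P i ≤ i := fun i => by
    by_cases hi : i ∈ Finset.Icc 1 m
    · exact blockMin_le (P.part_mem.2 hi) (P.mem_part hi) (P.mem_part hi)
    · exact (hself i hi).le
  refine ⟨hself, fun i hi => ?_, hle, fun i => ?_, fun b c hbc => ?_⟩
  · by_cases h : i ∈ Finset.Icc 1 m
    · exact (Finset.mem_Icc.1 (P.part_subset i (hmem i h))).1
    · rwa [hself i h]
  · by_cases h : i ∈ Finset.Icc 1 m
    · exact (blockMin_eq_iff_mem (P.part_mem.2 h) (P.mem_part h)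
        (P.part_subset i (hmem i h))).2 (hmem i h)
    · rw [hself i h, hself i h]
  · by_cases hc : c ∈ Finset.Icc 1 m
    · by_cases hb : b ∈ Finset.Icc 1 m
      -- A failure of nesting reads `f b < f c < b < c`, a crossing of the blocks of `b` and `c`.
      · by_contra! h
        have hne : blockMin P b ≠ blockMin P c := h.1.ne
        have := hP _ (P.part_mem.2 hb) _ (P.part_mem.2 hc) _ (hmem b hb) _ (hmem c hc) _
          (P.mem_part hb) _ (P.mem_part hc) h.1 h.2 hbc
        exact hne ((blockMin_eq_iff_mem (P.part_mem.2 hc) (P.mem_part hc) hb).2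
          (this ▸ P.mem_part hb))
      · simp only [Finset.mem_Icc] at hb hc
        exact Or.inr (by omega)
    · exact Or.inr (by rw [hself c hc]; omega)

theorem blockMin_injective {m : ℕ} :
    Function.Injective (blockMin : Finpartition (Finset.Icc 1 m) → ℕ → ℕ) := by
  have key : ∀ P Q : Finpartition (Finset.Icc 1 m), blockMin P = blockMin Q →
      ∀ A ∈ P.parts, A ∈ Q.parts := by
    intro P Q h A hA
    obtain ⟨i, hi⟩ := P.nonempty_of_mem_parts hA
    have hi' := P.le hA hi
    suffices A = Q.part i by rw [this]; exact Q.part_mem.2 hi'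
    ext x
    by_cases hx : x ∈ Finset.Icc 1 m
    · rw [← blockMin_eq_iff_mem hA hi hx, h,
        blockMin_eq_iff_mem (Q.part_mem.2 hi') (Q.mem_part hi') hx]
    · exact iff_of_false (fun h => hx (P.le hA h)) (fun h => hx (Q.part_subset i h))
  intro P Q h
  ext A
  exact ⟨key P Q h A, key Q P h.symm A⟩

open Classical in
/-- The partition of `[m]` into the fibres of `f`. -/
noncomputable def fibrePartition (m : ℕ) (f : ℕ → ℕ) : Finpartition (Finset.Icc 1 m) :=
  Finpartition.ofSetSetoid (Setoid.ker f) (Finset.Icc 1 m)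

theorem mem_part_fibrePartition {m : ℕ} {f : ℕ → ℕ} {i x : ℕ} :
    x ∈ (fibrePartition m f).part i ↔
      i ∈ Finset.Icc 1 m ∧ x ∈ Finset.Icc 1 m ∧ f i = f x := by
  rw [fibrePartition, Finpartition.mem_part_ofSetSetoid_iff_rel]
  rfl

theorem blockMin_fibrePartition {m : ℕ} {f : ℕ → ℕ} (hf : IsNoncrossingMin m f) :
    blockMin (fibrePartition m f) = f := by
  funext i
  by_cases hi : i ∈ Finset.Icc 1 m
  · have hA := (fibrePartition m f).part_mem.2 hi
    have hiA := (fibrePartition m f).mem_part hi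
    apply le_antisymm
    · refine blockMin_le hA hiA (mem_part_fibrePartition.2 ⟨hi, ?_, (hf.idem i).symm⟩)
      have := hf.le_self i
      have := hf.pos i (Finset.mem_Icc.1 hi).1
      simp only [Finset.mem_Icc] at hi ⊢
      omega
    · rw [(mem_part_fibrePartition.1 (blockMin_mem hA hiA)).2.2]
      exact hf.le_self _
  · rw [blockMin, dif_neg hi, hf.eq_self i hi]

theorem isNoncrossing_fibrePartition {m : ℕ} {f : ℕ → ℕ} (hf : IsNoncrossingMin m f) :
    IsNoncrossing (fibrePartition m f) := by
  intro A hA B hB a ha b hb c hc d hd hab hbc hcd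
  rw [← Finpartition.part_eq_of_mem _ hA ha, mem_part_fibrePartition] at hc
  rw [← Finpartition.part_eq_of_mem _ hB hb, mem_part_fibrePartition] at hd
  have h1 := hf.nested b c hbc
  have h2 := hf.nested c d hcd
  have h3 := hf.le_self a
  have h4 := hf.le_self b
  -- Since `f c = f a ≤ a < b`, nesting at `b < c` gives `f a ≤ f b`; likewise `c < d` gives `f b ≤
  -- f a`.
  have h : f a = f b := by omega
  refine Finpartition.eq_of_mem_parts _ hA hB (a := b) ?_ hb
  rw [← Finpartition.part_eq_of_mem _ hA ha, mem_part_fibrePartition]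
  exact ⟨hc.1, hd.1, h⟩

theorem blockMin_eq_one_iff {m : ℕ} {P : Finpartition (Finset.Icc 1 m)} {A : Finset ℕ}
    (hA : A ∈ P.parts) (h1 : 1 ∈ A) {x : ℕ} (hx : x ∈ Finset.Icc 1 m) :
    blockMin P x = 1 ↔ x ∈ A := by
  rw [← blockMin_eq_iff_mem hA h1 hx]
  have := blockMin_le hA h1 h1
  have := (Finset.mem_Icc.1 (P.le hA (blockMin_mem hA h1))).1
  rw [show blockMin P 1 = 1 by omega]

theorem filter_blockMin_eq_one {m : ℕ} {P : Finpartition (Finset.Icc 1 m)} {A : Finset ℕ}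
    (hA : A ∈ P.parts) (h1 : 1 ∈ A) :
    (Finset.Icc 1 m).filter (fun i => blockMin P i = 1) = A := by
  ext x
  rw [Finset.mem_filter]
  exact ⟨fun h => (blockMin_eq_one_iff hA h1 h.1).1 h.2,
    fun h => ⟨P.le hA h, (blockMin_eq_one_iff hA h1 (P.le hA h)).2 h⟩⟩

theorem blockMin_mem_noncrossingMin {r m : ℕ} (Q : RootedNoncrossing r m) (h1 : 1 ∈ Q.root) :
    blockMin Q.partition ∈ noncrossingMin m 1 r := by
  refine ⟨isNoncrossingMin_blockMin Q.noncrossing, fun i hi hi' => ?_, ?_⟩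
  · obtain rfl : i = 1 := by omega
    exact (blockMin_eq_one_iff Q.root_mem h1 (Q.partition.le Q.root_mem h1)).2 h1
  · rw [filter_blockMin_eq_one Q.root_mem h1, Q.root_card]

/-- The function of block minima, on the rooted non-crossing partitions whose root contains `1`. -/
def rootedBlockMin (r m : ℕ) (Q : {Q : RootedNoncrossing r m // 1 ∈ Q.root}) :
    noncrossingMin m 1 r :=
  ⟨blockMin Q.1.partition, blockMin_mem_noncrossingMin Q.1 Q.2⟩

theorem rootedBlockMin_bijective {r m : ℕ} (hm : 1 ≤ m) :
    Function.Bijective (rootedBlockMin r m) := by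
  constructor
  · rintro ⟨⟨P, hP, A, hA, hAr⟩, h1⟩ ⟨⟨P', hP', A', hA', hAr'⟩, h1'⟩ h
    obtain rfl : P = P' := blockMin_injective (congrArg Subtype.val h)
    obtain rfl : A = A' := P.eq_of_mem_parts hA hA' h1 h1'
    rfl
  · rintro ⟨f, hf⟩
    have hmem : 1 ∈ Finset.Icc 1 m := Finset.mem_Icc.2 ⟨le_rfl, hm⟩
    have hA := (fibrePartition m f).part_mem.2 hmem
    have h1 := (fibrePartition m f).mem_part hmem
    have hb := blockMin_fibrePartition hf.1
    refine ⟨⟨⟨fibrePartition m f, isNoncrossing_fibrePartition hf.1,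
      (fibrePartition m f).part 1, hA, ?_⟩, h1⟩, Subtype.ext hb⟩
    rw [← filter_blockMin_eq_one hA h1, hb, hf.2.2]

/-! ### Comparison of the two counts. -/

theorem encard_descendingStrictlyNaples_eq (k n : ℕ) :
    (descendingStrictlyNaples (k + 1) n).encard =
      (noncrossingMin (n + (k + 1) + 1) 1 (2 * (k + 1) + 2)).encard := by
  have h := encard_descendingStrictlyNaples k n
  -- For `n ≤ k + 1` both sides are empty: the root would need more elements than `[n + k + 2]` has,
  -- and raising the rule from `k` to `k + 1` adds no new functions.
  rcases Nat.lt_or_ge n (k + 2) with hn | hn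
  · have hempty : noncrossingMin (n + (k + 1) + 1) 1 (2 * (k + 1) + 2) = ∅ := by
      rw [Set.eq_empty_iff_forall_notMem]
      rintro f ⟨-, -, hr⟩
      have := Finset.card_filter_le (Finset.Icc 1 (n + (k + 1) + 1)) (fun i => f i = 1)
      simp only [Nat.card_Icc] at this
      omega
    rw [ballot_mono_of_le k n (by omega)] at h
    rw [hempty, Set.encard_empty]
    exact ENat.add_left_injective_of_ne_top (ENat.natCast_ne_top (ballot k n n))
      (by simpa only [zero_add] using h)
  · obtain ⟨d, rfl⟩ : ∃ d, n = d + k + 2 := ⟨n - (k + 2), by omega⟩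
    rw [ballot_touching, Nat.cast_add, add_comm] at h
    rw [encard_noncrossingMin (l := d + 2 * k + 3) (s := d) le_rfl (by omega) (by omega)]
    exact ENat.add_right_injective_of_ne_top (ENat.natCast_ne_top _) h

theorem finite_descendingStrictlyNaples (k n : ℕ) :
    (descendingStrictlyNaples (k + 1) n).Finite := by
  rw [← Set.encard_ne_top_iff]
  intro h
  have := encard_descendingStrictlyNaples k n
  rw [h, top_add] at this
  exact ENat.natCast_ne_top _ this.symm

end Naples

theorem theorem6p4 (k n : ℕ) (hk : 1 ≤ k) :
    Nonempty (Naples.descendingStrictlyNaples k n ≃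
      {Q : Naples.RootedNoncrossing (2 * k + 2) (n + k + 1) // 1 ∈ Q.root}) := by
  obtain ⟨k, rfl⟩ : ∃ j, k = j + 1 := ⟨k - 1, by omega⟩
  have hfin := Naples.finite_descendingStrictlyNaples k n
  have hcard := Naples.encard_descendingStrictlyNaples_eq k n
  have : Finite (Naples.descendingStrictlyNaples (k + 1) n) := hfin
  have : Finite (Naples.noncrossingMin (n + (k + 1) + 1) 1 (2 * (k + 1) + 2)) :=
    Set.encard_ne_top_iff.1 (hcard ▸ Set.encard_ne_top_iff.2 hfin)
  obtain ⟨e⟩ : Nonempty (Naples.descendingStrictlyNaples (k + 1) n ≃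
      Naples.noncrossingMin (n + (k + 1) + 1) 1 (2 * (k + 1) + 2)) :=
    Finite.card_eq.1 (by
      rw [Nat.card_coe_set_eq, Nat.card_coe_set_eq, Set.ncard, Set.ncard, hcard])
  exact ⟨e.trans
    (Equiv.ofBijective _ (Naples.rootedBlockMin_bijective (by omega))).symm⟩
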